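/- Let $G$ be a finite simple graph with vertex set $V(G)$. For $A\subseteq V(G)$ let $M_G(A)$ be the set consisting of the vertices of $A$ and all their neighbors, and let $G\setminus M_G(A)$ be the graph obtained from $G$ by deleting the vertices in $M_G(A)$. A vertex $k$-multicoloring of $G$ is a function $\kappa: V(G)\to\mathcal P(\{1,\dots,k\})$. It is called $a$-resistant if for every $A\subseteq V(G)$ with exactly $a$ vertices there is a connected component $H$ of $G\setminus M_G(A)$ such that $\bigcup_{u\in V(H)}\kappa(u)=\{1,\dots,k\}$. It is called highly $a$-resistant if, moreover, $\bigcup_{u\in A}\kappa(u)\neq\{1,\dots,k\}$ for every $A\subseteq V(G)$ with exactly $a$ vertices. Let $K(a,n)$ be the minimal number $k$ of colors for which some graph with $n$ vertices has a highly $a$-resistant vertex $k$-multicoloring, with $K(a,n)=\infty$ if no such $k$ exists. Theorem. For every integer $n\ge 3$, \[ K(3,n)=\begin{cases}\infty, & n\le 13;\\ 7, & n=14,15;\\ 4, & n\ge 16.\end{cases} \] -/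

import Mathlib

namespace SecretColoring

variable {V : Type*}

/-- `M_G(A)`: the vertices of `A` together with all their neighbors in `G`. -/
def closedNbhd (G : SimpleGraph V) (A : Set V) : Set V :=
  {v | ∃ u ∈ A, v = u ∨ G.Adj u v}

/-- The graph `G \ M_G(A)`, obtained by deleting the vertices of `A` and all their neighbors. -/
abbrev remaining (G : SimpleGraph V) (A : Set V) :
    SimpleGraph ((closedNbhd G A)ᶜ : Set V) :=
  G.induce (closedNbhd G A)ᶜ

/-- A vertex `k`-multicoloring `κ` (every vertex gets a subset of the `k` colors) is
`a`-resistant if for every set `A` of `a` vertices some connected component of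
`G \ M_G(A)` has all `k` colors. -/
def IsResistant (G : SimpleGraph V) (a : ℕ) {k : ℕ} (κ : V → Set (Fin k)) : Prop :=
  ∀ A : Finset V, A.card = a →
    ∃ H : (remaining G (A : Set V)).ConnectedComponent,
      (⋃ u ∈ H.supp, κ u.1) = Set.univ

/-- The multicoloring is highly `a`-resistant if it is `a`-resistant and no set of `a`
vertices has all `k` colors. -/
def IsHighlyResistant (G : SimpleGraph V) (a : ℕ) {k : ℕ} (κ : V → Set (Fin k)) : Prop :=
  IsResistant G a κ ∧
    ∀ A : Finset V, A.card = a → (⋃ u ∈ A, κ u) ≠ Set.univ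

/-- Some graph with `n` vertices has a highly `a`-resistant vertex `k`-multicoloring. -/
def Admits (a n k : ℕ) : Prop :=
  ∃ (G : SimpleGraph (Fin n)) (κ : Fin n → Set (Fin k)), IsHighlyResistant G a κ

/-- `K(a, n)`: the least number `k` of colors such that some graph with `n` vertices has a
highly `a`-resistant vertex `k`-multicoloring, and `∞` if there is no such `k`. -/
noncomputable def K (a n : ℕ) : ℕ∞ :=
  sInf ((fun k : ℕ => (k : ℕ∞)) '' {k : ℕ | Admits a n k})

end SecretColoring

namespace SecretColoring

open Finset

/-! ### Connected full sets and the discarding of small parts -/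

section Survives

variable {V : Type*} {G : SimpleGraph V} {k : ℕ} {κ : V → Set (Fin k)}

/-! For the lower bounds, any three vertices miss a color, so a connected piece with at most three
vertices is useless. After vertices are chosen, one may discard their closed neighborhoods and all
pieces of at most three vertices thereby cut off (`Survives.remove`). The question becomes how small
a set `W` can be that survives every choice of `s` vertices.

Take `W` minimal, and suppose that no single choice costs it four vertices. Then `G[W]` is
2-regular: a vertex with three neighbors, or a path ending in a leaf, would lose four vertices to
one choice or contain a free small component. Cycles of length 3 to 6 fall in the same way. What
remains is a path of eight vertices, all lost to two choices, or a cycle of length seven, also lost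
to two choices (`Critical.path_or_heptagon`). Induction on `s` gives at least 4, 7, 11, 14 vertices
for `s = 0, 1, 2, 3`.

A heptagon that survives one choice needs seven colors (`IsHeptagon.seven_le`). With at most six
colors the bounds rise to 4, 8, 12, 16. Two heptagons and four copies of the complete graph on four
vertices attain the values 14 and 16. -/

/-- `C` carries all colors. -/
def Full (κ : V → Set (Fin k)) (C : Finset V) : Prop :=
  ∀ c, ∃ v ∈ C, c ∈ κ v

/-- `C` induces a connected subgraph (or is empty), in terms of closure under adjacency. -/
def Linked (G : SimpleGraph V) (C : Finset V) : Prop :=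
  ∀ P : V → Prop, (∃ x ∈ C, P x) → (∀ x ∈ C, P x → ∀ y ∈ C, G.Adj x y → P y) → ∀ x ∈ C, P x

/-- However `s` vertices are chosen, a connected full set inside `W` avoids their closed
neighborhoods. -/
def Survives (G : SimpleGraph V) (κ : V → Set (Fin k)) (s : ℕ) (W : Finset V) : Prop :=
  ∀ A : Finset V, #A ≤ s → ∃ C ⊆ W, Linked G C ∧ Full κ C ∧
    ∀ b ∈ A, ∀ w ∈ C, w ≠ b ∧ ¬ G.Adj b w

theorem Full.mono {C D : Finset V} (h : Full κ C) (hCD : C ⊆ D) : Full κ D := fun c =>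
  let ⟨v, hv, hc⟩ := h c
  ⟨v, hCD hv, hc⟩

theorem not_survives_of_card_le_three (hκ : ∀ C : Finset V, #C ≤ 3 → ¬ Full κ C) {s : ℕ}
    {W : Finset V} (hW : #W ≤ 3) : ¬ Survives G κ s W := fun h =>
  let ⟨_, hC, _, hF, _⟩ := h ∅ (by simp)
  hκ _ ((card_le_card hC).trans hW) hF

/-- Placing `B` and discarding a small part `T` separated by the closed neighborhood of `B`. -/
theorem Survives.remove [DecidableEq V] (hκ : ∀ C : Finset V, #C ≤ 3 → ¬ Full κ C)
    {s t : ℕ} {W : Finset V} (h : Survives G κ (s + t) W) (B T : Finset V) (hB : #B ≤ t) (hT : #T ≤ 3)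
    (hsep : ∀ y ∈ T, ∀ z ∈ W, G.Adj y z → z ∈ T ∨ ∃ b ∈ B, z = b ∨ G.Adj b z)
    {W' : Finset V}
    (hW' : ∀ w ∈ W, w ∉ T → (∀ b ∈ B, w ≠ b ∧ ¬ G.Adj b w) → w ∈ W') :
    Survives G κ s W' := by
  intro A hA
  obtain ⟨C, hCW, hC, hF, hav⟩ := h (A ∪ B) ((card_union_le _ _).trans (by omega))
  have hdis : ∀ w ∈ C, w ∉ T := by
    intro w hw hwT
    -- A connected set that meets `T` can leave it only through the closed neighborhood of `B`,
    -- which `C` avoids; so it lies in `T` and is too small to be full.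
    have hsub : C ⊆ T := by
      intro u hu
      refine hC (· ∈ T) ⟨w, hw, hwT⟩ ?_ u hu
      intro x hx hxT y hy hxy
      rcases hsep x hxT y (hCW hy) hxy with h1 | ⟨b, hb, h2⟩
      · exact h1
      · have := hav b (mem_union_right _ hb) y hy
        tauto
    exact hκ C ((card_le_card hsub).trans hT) hF
  refine ⟨C, fun w hw => hW' w (hCW hw) (hdis w hw) fun b hb => hav b (mem_union_right _ hb) w hw,
    hC, hF, fun b hb => hav b (mem_union_left _ hb)⟩

/-- As `Survives.remove`, for a set `R` of vertices of `W` lost in this way. -/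
theorem Survives.sdiff [DecidableEq V] (hκ : ∀ C : Finset V, #C ≤ 3 → ¬ Full κ C)
    {s t : ℕ} {W : Finset V} (h : Survives G κ (s + t) W) (B T : Finset V) (hB : #B ≤ t) (hT : #T ≤ 3)
    (hsep : ∀ y ∈ T, ∀ z ∈ W, G.Adj y z → z ∈ T ∨ ∃ b ∈ B, z = b ∨ G.Adj b z)
    (R : Finset V) (hR : ∀ w ∈ R, w ∈ T ∨ ∃ b ∈ B, w = b ∨ G.Adj b w) :
    Survives G κ s (W \ R) := by
  refine h.remove hκ B T hB hT hsep fun w hw hwT hwB => mem_sdiff.2 ⟨hw, fun hwR => ?_⟩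
  rcases hR w hwR with h | ⟨b, hb, h⟩
  · exact hwT h
  · have := hwB b hb
    tauto

/-! ### Critical sets are 2-regular -/

/-- No vertices can be given up for free, nor four vertices at the price of one. -/
structure Critical (G : SimpleGraph V) (κ : V → Set (Fin k)) (s : ℕ) (W : Finset V) : Prop where
  small : ∀ C : Finset V, #C ≤ 3 → ¬ Full κ C
  survives : Survives G κ (s + 1) W
  minimal : ∀ W' ⊂ W, ¬ Survives G κ (s + 1) W'
  price : ∀ W' ⊆ W, #W' + 4 ≤ #W → ¬ Survives G κ s W'

namespace Critical

variable {s : ℕ} {W : Finset V}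

theorem nonempty (h : Critical G κ s W) : W.Nonempty := by
  rw [nonempty_iff_ne_empty]
  rintro rfl
  exact not_survives_of_card_le_three h.small (by simp) h.survives

/-- An inclusion-minimal surviving subset works; its `price` condition is the size bound already
known for `s`. This is how each induction on `s` starts. -/
theorem exists_of_survives (hκ : ∀ C : Finset V, #C ≤ 3 → ¬ Full κ C) {N : ℕ}
    (hN : ∀ W' : Finset V, #W' + 4 ≤ N → ¬ Survives G κ s W')
    (h : Survives G κ (s + 1) W) (hW : #W ≤ N) :
    ∃ W' ⊆ W, Critical G κ s W' := by
  obtain ⟨W', hle, hmin⟩ := exists_minimal_le_of_wellFoundedLT (Survives G κ (s + 1)) W h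
  refine ⟨W', hle, hκ, hmin.prop, fun U hU hs => hU.2 (hmin.le_of_le hs hU.1), fun U hU hc => ?_⟩
  exact hN U (hc.trans ((card_le_card hle).trans hW))

variable [DecidableEq V]

theorem false_of_drop (h : Critical G κ s W) (T : Finset V) (hT : #T ≤ 3) (hne : ∃ x ∈ T, x ∈ W)
    (hsep : ∀ y ∈ T, ∀ z ∈ W, G.Adj y z → z ∈ T) : False := by
  obtain ⟨x, hxT, hxW⟩ := hne
  refine h.minimal (W \ T) ?_ (Survives.sdiff h.small (t := 0) h.survives ∅ T (by simp) hT
    (fun y hy z hz hyz => Or.inl (hsep y hy z hz hyz)) T fun w hw => Or.inl hw)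
  exact ⟨sdiff_subset, fun hle => (mem_sdiff.1 (hle hxW)).2 hxT⟩

theorem false_of_one (h : Critical G κ s W) (b : V) (T : Finset V) (hT : #T ≤ 3)
    (hsep : ∀ y ∈ T, ∀ z ∈ W, G.Adj y z → z ∈ T ∨ z = b ∨ G.Adj b z)
    (R : Finset V) (hRW : R ⊆ W) (hR : ∀ w ∈ R, w ∈ T ∨ w = b ∨ G.Adj b w) (hc : 4 ≤ #R) :
    False := by
  refine h.price (W \ R) sdiff_subset ?_ (h.survives.sdiff h.small {b} T (by simp) hT
    (by simpa using hsep) R (by simpa using hR))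
  rw [card_sdiff_of_subset hRW]
  have := card_le_card hRW
  omega

/-- Choosing a vertex with three neighbors would cost `W` four vertices at once. -/
theorem eq_or_eq_of_adj (h : Critical G κ s W) {x a b : V} (hx : x ∈ W) (ha : a ∈ W) (hb : b ∈ W)
    (hab : a ≠ b) (hxa : G.Adj x a) (hxb : G.Adj x b) : ∀ y ∈ W, G.Adj x y → y = a ∨ y = b := by
  intro y hy hxy
  by_contra! hne
  refine h.false_of_one x ∅ (by simp) (by simp) {x, a, b, y} (by grind) (by grind) ?_
  exact (card_eq_four.2 ⟨x, a, b, y, by grind [G.ne_of_adj]⟩).ge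

/-- A vertex of degree at most one either lies in a component of at most three vertices, which is
dropped for free, or starts a path `x, p, q, r`. -/
theorem exists_neighbors (h : Critical G κ s W) {x : V} (hx : x ∈ W) :
    ∃ a ∈ W, ∃ b ∈ W, a ≠ b ∧ G.Adj x a ∧ G.Adj x b ∧
      ∀ y ∈ W, G.Adj x y → y = a ∨ y = b := by
  have h2 : ∃ a ∈ W, ∃ b ∈ W, a ≠ b ∧ G.Adj x a ∧ G.Adj x b := by
    by_contra! hcon
    by_cases h0 : ∃ a ∈ W, G.Adj x a
    · obtain ⟨p, hp, hxp⟩ := h0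
      have hx1 : ∀ y ∈ W, G.Adj x y → y = p := by grind
      by_cases h1 : ∃ q ∈ W, G.Adj p q ∧ q ≠ x
      · obtain ⟨q, hq, hpq, hqx⟩ := h1
        by_cases h3 : ∃ r ∈ W, G.Adj q r ∧ r ≠ p
        · obtain ⟨r, hr, hqr, hrp⟩ := h3
          have hrx : r ≠ x := by
            rintro rfl
            exact G.ne_of_adj hpq (hx1 q hq hqr.symm).symm
          have e1 := G.ne_of_adj hxp
          have e2 := G.ne_of_adj hpq
          have e3 := G.ne_of_adj hqr
          have e4 := hpq.symm
          -- Choosing `q` deletes `p`, `q`, `r` and isolates the leaf `x`.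
          refine h.false_of_one q {x} (by simp) ?_ {x, p, q, r} ?_ ?_ ?_
          · intro y hy z hz hyz
            grind
          · grind
          · grind
          · exact (card_eq_four.2 ⟨x, p, q, r, by grind⟩).ge
        · push Not at h3
          exact h.false_of_drop {x, p, q} card_le_three ⟨x, by simp, hx⟩ (by
            have := hpq.symm
            have := h.eq_or_eq_of_adj hp hx hq hqx.symm hxp.symm hpq
            grind)
      · push Not at h1
        exact h.false_of_drop {x, p} (card_le_two.trans (by norm_num)) ⟨x, by simp, hx⟩ (by grind)
    · exact h.false_of_drop {x} (by simp) ⟨x, by simp, hx⟩ (by grind)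
  obtain ⟨a, ha, b, hb, hab, hxa, hxb⟩ := h2
  exact ⟨a, ha, b, hb, hab, hxa, hxb, h.eq_or_eq_of_adj hx ha hb hab hxa hxb⟩

theorem exists_next (h : Critical G κ s W) {u x : V} (hu : u ∈ W) (hx : x ∈ W) (hux : G.Adj u x) :
    ∃ y ∈ W, y ≠ u ∧ G.Adj x y ∧ ∀ z ∈ W, G.Adj x z → z = u ∨ z = y := by
  obtain ⟨a, ha, b, hb, hab, hxa, hxb, hall⟩ := h.exists_neighbors hx
  have := hall u hu hux.symm
  grind

end Critical

/-! ### Paths on eight vertices and heptagons -/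

/-- `p` runs around a connected component of `G[W]` that is a cycle of length seven. -/
structure IsHeptagon (G : SimpleGraph V) (W : Finset V) (p : Fin 7 → V) : Prop where
  injective : Function.Injective p
  mem : ∀ i, p i ∈ W
  adj : ∀ i, G.Adj (p i) (p (i + 1))
  closed : ∀ i, ∀ y ∈ W, G.Adj (p i) y → y = p (i + 1) ∨ y = p (i + 6)

/-- Walk seven steps from `x` without turning back. By 2-regularity the walk can first repeat only
by returning to `x`. A triangle is dropped for free; in a cycle of length 4, 5 or 6, choosing `x1`
leaves at most three vertices, so the whole cycle is lost to one choice. -/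
theorem Critical.path_or_heptagon [DecidableEq V] {s : ℕ} {W : Finset V} (h : Critical G κ s W)
    {x : V} (hx : x ∈ W) :
    (∃ R ⊆ W, #R = 8 ∧ ∀ t, Survives G κ (t + 2) W → Survives G κ t (W \ R)) ∨
      ∃ p, IsHeptagon G W p ∧ p 0 = x := by
  obtain ⟨x1, h1, w, hw, hxw, a1, aw, n0⟩ := h.exists_neighbors hx
  obtain ⟨x2, h2, d2, a2, n1⟩ := h.exists_next hx h1 a1
  obtain ⟨x3, h3, d3, a3, n2⟩ := h.exists_next h1 h2 a2
  obtain ⟨x4, h4, d4, a4, n3⟩ := h.exists_next h2 h3 a3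
  obtain ⟨x5, h5, d5, a5, n4⟩ := h.exists_next h3 h4 a4
  obtain ⟨x6, h6, d6, a6, n5⟩ := h.exists_next h4 h5 a5
  obtain ⟨x7, h7, d7, a7, n6⟩ := h.exists_next h5 h6 a6
  have e1 := G.ne_of_adj a1
  have e2 := G.ne_of_adj a2
  have e3 := G.ne_of_adj a3
  have e4 := G.ne_of_adj a4
  have e5 := G.ne_of_adj a5
  have e6 := G.ne_of_adj a6
  have e7 := G.ne_of_adj a7
  have b1 := a1.symm
  have b2 := a2.symm
  have b3 := a3.symm
  have b4 := a4.symm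
  have b5 := a5.symm
  have b6 := a6.symm
  have b7 := a7.symm
  have n03 : x3 ≠ x := by
    rintro rfl
    refine h.false_of_drop {x3, x1, x2} card_le_three ⟨x3, by simp, hx⟩ ?_
    grind
  have n14 : x4 ≠ x1 := by grind
  have n04 : x4 ≠ x := by
    rintro rfl
    refine h.false_of_one x1 {x3} (by simp) ?_ {x4, x1, x2, x3} (by grind) (by grind)
      (card_eq_four.2 ⟨_, _, _, _, ?_, ?_, ?_, ?_, ?_, ?_, rfl⟩).ge
    all_goals grind
  have n15 : x5 ≠ x1 := by grind
  have n25 : x5 ≠ x2 := by grind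
  have n05 : x5 ≠ x := by
    rintro rfl
    refine h.false_of_one x1 {x3, x4} card_le_two.step ?_ {x5, x1, x2, x3} (by grind) (by grind)
      (card_eq_four.2 ⟨_, _, _, _, ?_, ?_, ?_, ?_, ?_, ?_, rfl⟩).ge
    all_goals grind
  have n16 : x6 ≠ x1 := by grind
  have n26 : x6 ≠ x2 := by grind
  have n36 : x6 ≠ x3 := by grind
  have n06 : x6 ≠ x := by
    rintro rfl
    refine h.false_of_one x1 {x3, x4, x5} card_le_three ?_ {x6, x1, x2, x3} (by grind) (by grind)
      (card_eq_four.2 ⟨_, _, _, _, ?_, ?_, ?_, ?_, ?_, ?_, rfl⟩).ge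
    all_goals grind
  have n17 : x7 ≠ x1 := by grind
  have n27 : x7 ≠ x2 := by grind
  have n37 : x7 ≠ x3 := by grind
  have n47 : x7 ≠ x4 := by grind
  by_cases n07 : x7 = x
  · subst n07
    right
    refine ⟨![x7, x1, x2, x3, x4, x5, x6], ⟨?_, ?_, ?_, ?_⟩, rfl⟩
    · rw [← List.nodup_ofFn]
      simp
      grind
    · simp [Fin.forall_fin_succ, *]
    · intro i
      fin_cases i <;> assumption
    · intro i y hy hiy
      fin_cases i
      · have hiy' : G.Adj x7 y := hiy
        have : y = x1 ∨ y = x6 := by grind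
        exact this
      · exact (n1 y hy hiy).symm
      · exact (n2 y hy hiy).symm
      · exact (n3 y hy hiy).symm
      · exact (n4 y hy hiy).symm
      · exact (n5 y hy hiy).symm
      · exact (n6 y hy hiy).symm
  · left
    -- Choosing `x1` and `x6` deletes all of the path but `x3` and `x4`, which are cut off from the
    -- rest.
    refine ⟨[x, x1, x2, x3, x4, x5, x6, x7].toFinset, by simp [insert_subset_iff, *], ?_,
      fun t ht => ht.sdiff h.small {x1, x6} {x3, x4} card_le_two card_le_two.step ?_ _ ?_⟩
    · refine List.toFinset_card_of_nodup ?_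
      simp
      grind
    · grind
    · simp
      grind

namespace IsHeptagon

variable {W : Finset V} {p : Fin 7 → V}

theorem mem_of_adj (hp : IsHeptagon G W p) {x y : V} (hy : y ∈ W)
    (hxy : G.Adj x y) (h : x ∈ Set.range p) : y ∈ Set.range p := by
  obtain ⟨i, rfl⟩ := h
  rcases hp.closed i y hy hxy with rfl | rfl <;> simp

/-- Two components that are heptagons coincide or are disjoint. -/
theorem notMem_range (hp : IsHeptagon G W p) {q : Fin 7 → V} (hq : IsHeptagon G W q)
    (h : q 0 ∉ Set.range p) (i : Fin 7) : q i ∉ Set.range p := by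
  induction i using Fin.induction with
  | zero => exact h
  | succ i ih =>
    intro hi
    have := hq.adj i.castSucc
    rw [Fin.coeSucc_eq_succ] at this
    exact ih (hp.mem_of_adj (hq.mem _) this.symm hi)

theorem card_image [DecidableEq V] (hp : IsHeptagon G W p) : #(univ.image p) = 7 := by
  rw [card_image_of_injective _ hp.injective]
  simp

theorem image_subset [DecidableEq V] (hp : IsHeptagon G W p) : univ.image p ⊆ W := by
  simpa [image_subset_iff] using hp.mem

theorem card_le [DecidableEq V] (hp : IsHeptagon G W p) : 7 ≤ #W :=
  hp.card_image.ge.trans (card_le_card hp.image_subset)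

theorem disjoint_image [DecidableEq V] (hp : IsHeptagon G W p) {q : Fin 7 → V}
    (hq : IsHeptagon G W q) (h : q 0 ∉ Set.range p) :
    Disjoint (univ.image p) (univ.image q) := by
  refine disjoint_right.2 fun y hy hyp => ?_
  obtain ⟨i, -, rfl⟩ := mem_image.1 hy
  exact hp.notMem_range hq h i (by simpa using hyp)

/-- Choosing `p 1` and `p 5` deletes six vertices of the heptagon and isolates the seventh, `p 3`.
-/
theorem survives_sdiff [DecidableEq V] (hp : IsHeptagon G W p)
    (hκ : ∀ C : Finset V, #C ≤ 3 → ¬ Full κ C) {t : ℕ} (h : Survives G κ (t + 2) W) :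
    Survives G κ t (W \ univ.image p) := by
  refine h.sdiff hκ {p 1, p 5} {p 3} card_le_two (by simp) ?_ _ ?_
  · intro y hy z hz hyz
    obtain rfl := mem_singleton.1 hy
    have h1 := hp.adj 1
    have h5 := (hp.adj 4).symm
    rcases hp.closed 3 z hz hyz with rfl | rfl
    · exact Or.inr ⟨p 5, by simp, Or.inr h5⟩
    · exact Or.inr ⟨p 1, by simp, Or.inr h1⟩
  · have h0 := (hp.adj 0).symm
    have h1 := hp.adj 1
    have h4 := (hp.adj 4).symm
    have h5 := hp.adj 5
    simp only [mem_image, mem_univ, true_and, forall_exists_index, forall_apply_eq_imp_iff]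
    intro i
    fin_cases i <;> simp_all

/-- A heptagon surviving the choice of any one vertex needs seven colors: a color missing from
two sets of three consecutive vertices is missing from four consecutive ones. -/
theorem seven_le [DecidableEq V] (hp : IsHeptagon G W p)
    (hκ : ∀ C : Finset V, #C ≤ 3 → ¬ Full κ C) (hW : W ⊆ univ.image p)
    (h : Survives G κ 1 W) : 7 ≤ k := by
  -- Choosing `p i` leaves just these four vertices, so they must carry every color.
  have hfull : ∀ i, Full κ {p (i + 2), p (i + 3), p (i + 4), p (i + 5)} := by
    intro i
    obtain ⟨C, hCW, -, hF, hav⟩ := h {p i} (by simp)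
    refine hF.mono fun w hw => ?_
    obtain ⟨j, -, rfl⟩ := mem_image.1 (hW (hCW hw))
    obtain ⟨h1, h2⟩ := hav (p i) (by simp) _ hw
    have h3 : j ≠ i := fun e => h1 (e ▸ rfl)
    have h4 : j ≠ i + 1 := fun e => h2 (e ▸ hp.adj i)
    have h5 : j ≠ i + 6 := by
      rintro rfl
      have := (hp.adj (i + 6)).symm
      rw [add_assoc, show (6 + 1 : Fin 7) = 0 from rfl, add_zero] at this
      exact h2 this
    have : j = i + 2 ∨ j = i + 3 ∨ j = i + 4 ∨ j = i + 5 := by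
      clear * - h3 h4 h5
      revert i j
      decide
    rcases this with rfl | rfl | rfl | rfl <;> simp
  have hmiss : ∀ i, ∃ c, c ∉ κ (p i) ∧ c ∉ κ (p (i + 1)) ∧ c ∉ κ (p (i + 2)) := by
    intro i
    have := hκ {p i, p (i + 1), p (i + 2)} card_le_three
    simpa [Full] using this
  choose c hc using hmiss
  by_contra! hk
  obtain ⟨i, j, hij, hcij⟩ := Fintype.exists_ne_map_eq_of_card_lt c (by simpa using hk)
  have key : ∃ l : Fin 7, ∀ m ∈ ({l + 2, l + 3, l + 4, l + 5} : Finset (Fin 7)),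
      m ∈ ({i, i + 1, i + 2, j, j + 1, j + 2} : Finset (Fin 7)) := by
    clear * - hij
    revert i j
    decide
  obtain ⟨l, hl⟩ := key
  have hci := hc i
  have hcj := hc j
  rw [← hcij] at hcj
  have hall : ∀ m ∈ ({i, i + 1, i + 2, j, j + 1, j + 2} : Finset (Fin 7)), c i ∉ κ (p m) := by
    simp [hci, hcj]
  obtain ⟨v, hv, hcv⟩ := hfull l (c i)
  simp only [mem_insert, mem_singleton] at hv
  rcases hv with rfl | rfl | rfl | rfl <;> exact hall _ (hl _ (by simp)) hcv

end IsHeptagon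

/-! ### Lower bounds on the size of surviving sets -/

theorem not_survives_one (hκ : ∀ C : Finset V, #C ≤ 3 → ¬ Full κ C) {W : Finset V}
    (hW : #W ≤ 6) : ¬ Survives G κ 1 W := by
  classical
  intro h
  obtain ⟨U, hU, hc⟩ := Critical.exists_of_survives hκ (N := 6)
    (fun W' hW' => not_survives_of_card_le_three hκ (by omega)) h hW
  have hcard := (card_le_card hU).trans hW
  obtain ⟨x, hx⟩ := hc.nonempty
  rcases hc.path_or_heptagon hx with ⟨R, hR, hR8, -⟩ | ⟨p, hp, -⟩
  · have := card_le_card hR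
    omega
  · have := hp.card_le
    omega

/-- Two choices cost at least seven vertices, in either case of `Critical.path_or_heptagon`. The
bound for `s` thus follows from that for `s - 2`, while the bound for `s - 1` supplies criticality.
-/
theorem Critical.exists_survives [DecidableEq V] {t : ℕ} {W : Finset V}
    (h : Critical G κ (t + 1) W) : ∃ W' ⊆ W, #W' + 7 ≤ #W ∧ Survives G κ t W' := by
  obtain ⟨x, hx⟩ := h.nonempty
  rcases h.path_or_heptagon hx with ⟨R, hR, hR8, hs⟩ | ⟨p, hp, -⟩
  · refine ⟨W \ R, sdiff_subset, ?_, hs t h.survives⟩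
    have := card_le_card hR
    rw [card_sdiff_of_subset hR]
    omega
  · refine ⟨W \ univ.image p, sdiff_subset, ?_, hp.survives_sdiff h.small h.survives⟩
    have := hp.card_le
    rw [card_sdiff_of_subset hp.image_subset, hp.card_image]
    omega

theorem not_survives_two (hκ : ∀ C : Finset V, #C ≤ 3 → ¬ Full κ C) {W : Finset V}
    (hW : #W ≤ 10) : ¬ Survives G κ 2 W := by
  classical
  intro h
  obtain ⟨U, hU, hc⟩ := Critical.exists_of_survives hκ (N := 10)
    (fun W' hW' => not_survives_one hκ (by omega)) h hW
  have hcard := (card_le_card hU).trans hW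
  obtain ⟨W', -, hW', hs⟩ := hc.exists_survives
  exact not_survives_of_card_le_three hκ (by omega) hs

theorem not_survives_three (hκ : ∀ C : Finset V, #C ≤ 3 → ¬ Full κ C) {W : Finset V}
    (hW : #W ≤ 13) : ¬ Survives G κ 3 W := by
  classical
  intro h
  obtain ⟨U, hU, hc⟩ := Critical.exists_of_survives hκ (N := 13)
    (fun W' hW' => not_survives_two hκ (by omega)) h hW
  have hcard := (card_le_card hU).trans hW
  obtain ⟨W', -, hW', hs⟩ := hc.exists_survives
  exact not_survives_one hκ (by omega) hs

/-- A critical set of at most seven vertices could only be a single heptagon, and that needs seven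
colors. -/
theorem not_survives_one_of_le_six (hk : k ≤ 6) (hκ : ∀ C : Finset V, #C ≤ 3 → ¬ Full κ C)
    {W : Finset V} (hW : #W ≤ 7) : ¬ Survives G κ 1 W := by
  classical
  intro h
  obtain ⟨U, hU, hc⟩ := Critical.exists_of_survives hκ (N := 7)
    (fun W' hW' => not_survives_of_card_le_three hκ (by omega)) h hW
  have hcard := (card_le_card hU).trans hW
  obtain ⟨x, hx⟩ := hc.nonempty
  rcases hc.path_or_heptagon hx with ⟨R, hR, hR8, -⟩ | ⟨p, hp, -⟩
  · have := card_le_card hR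
    omega
  · have := hp.seven_le hκ
      (eq_of_subset_of_card_le hp.image_subset (by rw [hp.card_image]; exact hcard)).ge
      hc.survives
    omega

/-- Without a path on eight vertices, all components are heptagons. -/
theorem Critical.exists_survives_or_card_eq [DecidableEq V] {t : ℕ} {W : Finset V}
    (h : Critical G κ (t + 1) W) (hW : #W ≤ 20) :
    (∃ W' ⊆ W, #W' + 8 ≤ #W ∧ Survives G κ t W') ∨
    (∃ W' ⊆ W, #W' + 7 ≤ #W ∧ Survives G κ t W') ∧ (#W = 7 ∨ #W = 14) := by
  refine or_iff_not_imp_left.2 fun hno => ?_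
  have hhep : ∀ x ∈ W, ∃ p, IsHeptagon G W p ∧ p 0 = x := by
    intro x hx
    refine (h.path_or_heptagon hx).resolve_left ?_
    rintro ⟨R, hR, hR8, hs⟩
    refine hno ⟨W \ R, sdiff_subset, ?_, hs t h.survives⟩
    have := card_le_card hR
    rw [card_sdiff_of_subset hR]
    omega
  refine ⟨h.exists_survives, ?_⟩
  obtain ⟨x, hx⟩ := h.nonempty
  obtain ⟨p, hp, -⟩ := hhep x hx
  have hpc := hp.card_le
  by_cases h1 : W ⊆ univ.image p
  · left
    have := card_le_card h1
    rw [hp.card_image] at this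
    omega
  obtain ⟨y, hy, hyp⟩ := not_subset.1 h1
  obtain ⟨q, hq, rfl⟩ := hhep y hy
  have hpq := hp.disjoint_image hq (by simpa using hyp)
  have hsub := union_subset hp.image_subset hq.image_subset
  have hc2 := card_union_of_disjoint hpq
  rw [hp.card_image, hq.card_image] at hc2
  by_cases h2 : W ⊆ univ.image p ∪ univ.image q
  · right
    rw [← hsub.antisymm h2, hc2]
  obtain ⟨z, hz, hzpq⟩ := not_subset.1 h2
  rw [mem_union, not_or] at hzpq
  obtain ⟨r, hr, rfl⟩ := hhep z hz
  have hpr := hp.disjoint_image hr (by simpa using hzpq.1)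
  have hqr := hq.disjoint_image hr (by simpa using hzpq.2)
  have hc3 := card_union_of_disjoint (disjoint_union_left.2 ⟨hpr, hqr⟩)
  rw [hc2, hr.card_image] at hc3
  have := card_le_card (union_subset hsub hr.image_subset)
  -- A third disjoint heptagon would bring the size to 21.
  omega

theorem not_survives_two_of_le_six (hk : k ≤ 6) (hκ : ∀ C : Finset V, #C ≤ 3 → ¬ Full κ C)
    {W : Finset V} (hW : #W ≤ 11) : ¬ Survives G κ 2 W := by
  classical
  intro h
  obtain ⟨U, hU, hc⟩ := Critical.exists_of_survives hκ (N := 11)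
    (fun W' hW' => not_survives_one_of_le_six hk hκ (by omega)) h hW
  have hcard := (card_le_card hU).trans hW
  rcases hc.exists_survives_or_card_eq (by omega) with ⟨W', -, hW', hs⟩ | ⟨⟨W', -, hW', hs⟩, hd⟩ <;>
  exact not_survives_of_card_le_three hκ (by omega) hs

theorem not_survives_three_of_le_six (hk : k ≤ 6) (hκ : ∀ C : Finset V, #C ≤ 3 → ¬ Full κ C)
    {W : Finset V} (hW : #W ≤ 15) : ¬ Survives G κ 3 W := by
  classical
  intro h
  obtain ⟨U, hU, hc⟩ := Critical.exists_of_survives hκ (N := 15)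
    (fun W' hW' => not_survives_two_of_le_six hk hκ (by omega)) h hW
  have hcard := (card_le_card hU).trans hW
  -- At most seven vertices must remain. Losing eight of fifteen suffices; losing only seven
  -- suffices because the size is then at most 14.
  rcases hc.exists_survives_or_card_eq (by omega) with ⟨W', -, hW', hs⟩ | ⟨⟨W', -, hW', hs⟩, hd⟩ <;>
  exact not_survives_one_of_le_six hk hκ (by omega) hs

end Survives
variable {n k : ℕ}

/-! ### From highly resistant colorings to surviving sets -/

theorem IsHighlyResistant.not_full {V : Type*} [Fintype V] {G : SimpleGraph V}
    {κ : V → Set (Fin k)} {a : ℕ} (h : IsHighlyResistant G a κ) (ha : a ≤ Fintype.card V)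
    (C : Finset V) (hC : #C ≤ a) : ¬ Full κ C := by
  intro hF
  obtain ⟨A, hCA, hA⟩ := exists_superset_card_eq hC ha
  refine h.2 A hA (Set.eq_univ_of_forall fun c => ?_)
  obtain ⟨v, hv, hc⟩ := hF c
  exact Set.mem_biUnion (hCA hv) hc

/-- A smaller set of chosen vertices is enlarged to exactly `a` vertices, which is possible as `a`
is at most the order of the graph. The full component is then transported to a set of vertices of
`G`. -/
theorem IsHighlyResistant.survives {V : Type*} [Fintype V] {G : SimpleGraph V}
    {κ : V → Set (Fin k)} {a : ℕ} (h : IsHighlyResistant G a κ) (ha : a ≤ Fintype.card V) :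
    Survives G κ a univ := by
  classical
  intro A' hA'
  obtain ⟨A, hAA, hA⟩ := exists_superset_card_eq hA' ha
  obtain ⟨H, hH⟩ := h.1 A hA
  refine ⟨univ.filter fun v => ∃ u ∈ H.supp, u.1 = v, subset_univ _, ?_, ?_, ?_⟩
  · rintro P ⟨x, hx, hPx⟩ hP y hy
    obtain ⟨x, hxH, rfl⟩ := (mem_filter.1 hx).2
    obtain ⟨y, hyH, rfl⟩ := (mem_filter.1 hy).2
    obtain ⟨w⟩ := SimpleGraph.ConnectedComponent.exact
      ((SimpleGraph.ConnectedComponent.mem_supp_iff _ _).1 hxH |>.trans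
        ((SimpleGraph.ConnectedComponent.mem_supp_iff _ _).1 hyH).symm)
    clear hx hy hyH
    induction w with
    | nil => exact hPx
    | @cons u v _ huv _ ih =>
      have hv : v ∈ H.supp := (SimpleGraph.ConnectedComponent.mem_supp_congr_adj H huv).1 hxH
      exact ih hv (hP _ (mem_filter.2 ⟨mem_univ _, u, hxH, rfl⟩) hPx _
        (mem_filter.2 ⟨mem_univ _, v, hv, rfl⟩) huv)
  · intro c
    have hc : c ∈ ⋃ u ∈ H.supp, κ u.1 := hH ▸ Set.mem_univ c
    obtain ⟨u, hu, hcu⟩ := Set.mem_iUnion₂.1 hc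
    exact ⟨u, mem_filter.2 ⟨mem_univ _, u, hu, rfl⟩, hcu⟩
  · intro b hb w hw
    obtain ⟨w, -, rfl⟩ := (mem_filter.1 hw).2
    have hw := w.2
    refine ⟨fun e => hw ⟨b, hAA hb, Or.inl e⟩, fun e => hw ⟨b, hAA hb, Or.inr e⟩⟩

theorem not_admits_of_le_thirteen (hn : 3 ≤ n) (h13 : n ≤ 13) : ¬ Admits 3 n k := by
  rintro ⟨G, κ, h⟩
  exact not_survives_three (h.not_full (by simpa using hn)) (by simpa using h13)
    (h.survives (by simpa using hn))

theorem seven_le_of_admits (hn : 3 ≤ n) (h15 : n ≤ 15) (h : Admits 3 n k) : 7 ≤ k := by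
  obtain ⟨G, κ, h⟩ := h
  by_contra! hk
  exact not_survives_three_of_le_six (by omega) (h.not_full (by simpa using hn))
    (by simpa using h15) (h.survives (by simpa using hn))

/-- Every color lies on some vertex, so `k` vertices suffice to have all the colors. -/
theorem four_le_of_admits (hn : 3 ≤ n) (h : Admits 3 n k) : 4 ≤ k := by
  obtain ⟨G, κ, h⟩ := h
  by_contra! hk
  obtain ⟨C, -, -, hF, -⟩ := h.survives (by simpa using hn) ∅ (by simp)
  choose f hf hc using hF
  refine h.not_full (by simpa using hn) (univ.image f) (card_image_le.trans ?_)
    fun c => ⟨f c, by simp, hc c⟩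
  simp
  omega

/-! ### Constructions with four and with seven colors -/

/-- Resistance may be checked on paths with four vertices that have all the colors. -/
theorem isResistant_of_path {V : Type*} {G : SimpleGraph V} {a : ℕ} {κ : V → Set (Fin k)}
    (h : ∀ A : Finset V, #A = a → ∃ p : Fin 4 → V, (∀ i, p i ∉ closedNbhd G (A : Set V)) ∧
      G.Adj (p 0) (p 1) ∧ G.Adj (p 1) (p 2) ∧ G.Adj (p 2) (p 3) ∧ ∀ c, ∃ i, c ∈ κ (p i)) :
    IsResistant G a κ := by
  intro A hA
  obtain ⟨p, hp, h01, h12, h23, hc⟩ := h A hA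
  let q : Fin 4 → ((closedNbhd G (A : Set V))ᶜ : Set V) := fun i => ⟨p i, hp i⟩
  have a01 : (remaining G (A : Set V)).Adj (q 0) (q 1) := h01
  have a12 : (remaining G (A : Set V)).Adj (q 1) (q 2) := h12
  have a23 : (remaining G (A : Set V)).Adj (q 2) (q 3) := h23
  have r1 := a01.reachable.symm
  have r2 := a12.reachable.symm.trans r1
  have r3 := a23.reachable.symm.trans r2
  refine ⟨(remaining G (A : Set V)).connectedComponentMk (q 0),
    Set.eq_univ_of_forall fun c => ?_⟩
  obtain ⟨i, hi⟩ := hc c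
  refine Set.mem_iUnion₂.2 ⟨q i, ?_, hi⟩
  rw [SimpleGraph.ConnectedComponent.mem_supp_iff, SimpleGraph.ConnectedComponent.eq]
  fin_cases i
  exacts [SimpleGraph.Reachable.refl _, r1, r2, r3]

theorem iUnion_ne_univ_of_ncard_le {V : Type*} {κ : V → Set (Fin k)} {a d : ℕ}
    (hκ : ∀ v, (κ v).ncard ≤ d) (hk : a * d < k) (A : Finset V) (hA : #A = a) :
    (⋃ u ∈ A, κ u) ≠ Set.univ := by
  intro h
  have h1 : (⋃ u ∈ A, κ u).ncard ≤ ∑ u ∈ A, (κ u).ncard := Finset.set_ncard_biUnion_le A κ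
  have h2 : ∑ u ∈ A, (κ u).ncard ≤ #A * d := sum_le_card_nsmul _ _ _ fun u _ => hκ u
  rw [h, Set.ncard_univ, Nat.card_eq_fintype_card, Fintype.card_fin] at h1
  rw [hA] at h2
  omega

/-- Four disjoint complete graphs on four vertices. -/
theorem admits_four (hn : 16 ≤ n) : Admits 3 n 4 := by
  let G : SimpleGraph (Fin n) :=
    { Adj := fun u v => u ≠ v ∧ u.1 / 4 = v.1 / 4
      symm := ⟨fun u v h => ⟨h.1.symm, h.2.symm⟩⟩
      loopless := ⟨fun u h => h.1 rfl⟩ }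
  let κ : Fin n → Set (Fin 4) := fun v => {c | c.1 = v.1 % 4}
  refine ⟨G, κ, isResistant_of_path ?_, iUnion_ne_univ_of_ncard_le (d := 1) ?_ (by norm_num)⟩
  · intro A hA
    have : ∃ b ∈ range 4, b ∉ A.image fun v => v.1 / 4 := by
      by_contra! hcon
      have := (card_le_card hcon).trans card_image_le
      simp [hA] at this
    obtain ⟨b, hb, hbA⟩ := this
    rw [Finset.mem_range] at hb
    refine ⟨fun i => ⟨4 * b + i, by omega⟩, ?_, ?_, ?_, ?_, ?_⟩
    · rintro i ⟨u, hu, h⟩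
      refine hbA (mem_image.2 ⟨u, hu, ?_⟩)
      rcases h with h | h
      · rw [← h]
        simp
        omega
      · rw [h.2]
        simp
        omega
    · simp [G]; omega
    · simp [G]; omega
    · simp [G]; omega
    · intro c
      refine ⟨c, ?_⟩
      simp [κ]
      omega
  · intro v
    refine (Set.ncard_le_one).2 fun c hc d hd => Fin.ext ?_
    simp only [κ, Set.mem_ofPred_eq] at hc hd
    omega

/-- Two disjoint heptagons, whose vertices have the colors `i` and `i + 3`. -/
theorem admits_seven (hn : 14 ≤ n) : Admits 3 n 7 := by
  let G : SimpleGraph (Fin n) :=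
    { Adj := fun u v => u.1 / 7 = v.1 / 7 ∧
        ((u.1 % 7 + 1) % 7 = v.1 % 7 ∨ (v.1 % 7 + 1) % 7 = u.1 % 7)
      symm := ⟨fun u v h => ⟨h.1.symm, h.2.symm⟩⟩
      loopless := ⟨fun u h => by omega⟩ }
  let κ : Fin n → Set (Fin 7) := fun v => {c | c.1 = v.1 % 7 ∨ c.1 = (v.1 + 3) % 7}
  refine ⟨G, κ, isResistant_of_path ?_, iUnion_ne_univ_of_ncard_le (d := 2) ?_ (by norm_num)⟩
  · intro A hA
    have : ∃ b < 2, ∃ i < 7, ∀ u ∈ A, u.1 / 7 = b → u.1 % 7 = i := by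
      -- Three chosen vertices cannot put two into each of the heptagons.
      have hb : ∃ b < 2, #(A.filter fun u => u.1 / 7 = b) ≤ 1 := by
        by_contra! hcon
        have h0 := hcon 0 (by norm_num)
        have h1 := hcon 1 (by norm_num)
        have hd : Disjoint (A.filter fun u => u.1 / 7 = 0) (A.filter fun u => u.1 / 7 = 1) := by
          refine disjoint_filter.2 fun u _ h => ?_
          omega
        have := card_le_card (union_subset (filter_subset (fun u => u.1 / 7 = 0) A)
          (filter_subset (fun u => u.1 / 7 = 1) A))
        rw [card_union_of_disjoint hd] at this
        omega
      obtain ⟨b, hb, hc⟩ := hb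
      rw [card_le_one] at hc
      by_cases hne : ∃ v ∈ A, v.1 / 7 = b
      · obtain ⟨v, hv, hvb⟩ := hne
        refine ⟨b, hb, v.1 % 7, Nat.mod_lt _ (by norm_num), fun u hu hub => ?_⟩
        rw [hc u (by simp [hu, hub]) v (by simp [hv, hvb])]
      · push Not at hne
        -- No vertex is chosen in this heptagon, so any position `i` serves.
        exact ⟨b, hb, 0, by norm_num, fun u hu hub => absurd hub (hne u hu)⟩
    obtain ⟨b, hb, i, hi, hA⟩ := this
    -- These are the four vertices left when position `i` and its two neighbors are deleted. Their
    -- colors run through `i + 2, …, i + 5` and `i + 5, …, i + 8`, hence through all residues modulo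
    -- 7.
    refine ⟨fun j => ⟨7 * b + (i + 2 + j) % 7, by omega⟩, ?_, ?_, ?_, ?_, ?_⟩
    · rintro j ⟨u, hu, h⟩
      have hAu := hA u hu
      have hj := j.2
      rcases h with h | h
      · rw [← h] at hAu
        simp at hAu
        omega
      · simp [G] at h
        omega
    · simp [G]; omega
    · simp [G]; omega
    · simp [G]; omega
    · intro c
      have hc := c.2
      have : ∃ j < 4, c.1 = (i + 2 + j) % 7 ∨ c.1 = ((i + 2 + j) % 7 + 3) % 7 := by
        generalize c.1 = c at hc
        clear * - hc hi
        revert c i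
        decide
      obtain ⟨j, hj, h⟩ := this
      refine ⟨⟨j, hj⟩, ?_⟩
      simp only [κ, Set.mem_ofPred_eq]
      omega
  · intro v
    refine (Set.ncard_le_ncard (t := {⟨v.1 % 7, Nat.mod_lt _ (by norm_num)⟩,
      ⟨(v.1 + 3) % 7, Nat.mod_lt _ (by norm_num)⟩}) ?_).trans ((Set.ncard_insert_le _ _).trans (by simp))
    rintro c (hc | hc)
    · exact Or.inl (Fin.ext hc)
    · exact Or.inr (Fin.ext hc)

theorem K_eq_of_isLeast {a m : ℕ} (hm : Admits a n m) (hle : ∀ k, Admits a n k → m ≤ k) :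
    K a n = m := by
  refine IsLeast.csInf_eq ⟨Set.mem_image_of_mem _ hm, ?_⟩
  rintro _ ⟨k, hk, rfl⟩
  exact Nat.cast_le.2 (hle k hk)

end SecretColoring

theorem theorem6 (n : ℕ) (hn : 3 ≤ n) :
    (n ≤ 13 → SecretColoring.K 3 n = ⊤) ∧
    (n = 14 ∨ n = 15 → SecretColoring.K 3 n = 7) ∧
    (16 ≤ n → SecretColoring.K 3 n = 4) := by
  refine ⟨fun h => ?_, fun h => ?_, fun h => ?_⟩
  · rw [SecretColoring.K, sInf_eq_top]
    rintro _ ⟨k, hk, rfl⟩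
    exact absurd hk (SecretColoring.not_admits_of_le_thirteen hn h)
  · exact SecretColoring.K_eq_of_isLeast (SecretColoring.admits_seven (by omega))
      fun k hk => SecretColoring.seven_le_of_admits hn (by omega) hk
  · exact SecretColoring.K_eq_of_isLeast (SecretColoring.admits_four h)
      fun k hk => SecretColoring.four_le_of_admits hn hk
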